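/- Let $\Gamma$ be a finite simple graph with vertex set $X=\{x_1,\dots,x_n\}$ whose edges $\{x_i,x_j\}$ are labelled by integers $m_{ij}\ge 2$. Let $A_\Gamma=\langle X\mid x_ix_jx_i\cdots=x_jx_ix_j\cdots \text{ (both words of length } m_{ij}) \text{ for every edge }\{x_i,x_j\}\rangle$ be the associated Artin group, let $M=A_\Gamma^+$ be the Artin monoid, i.e. the submonoid of $A_\Gamma$ consisting of the positive words in $X$, and for $T\subseteq X$ let $A_T$ be the subgroup of $A_\Gamma$ generated by $T$. The subset $T$ is of spherical type if the Coxeter group defined by the full labelled subgraph of $\Gamma$ spanned by $T$ is finite. Assume that $A_\Gamma$ is of infinite type, i.e. that the Coxeter group defined by $\Gamma$ is infinite. Let $\mathrm{Cay}(A_\Gamma,M)$ be the Cayley graph: its vertices are the elements of $A_\Gamma$, and $g,h$ are joined by an edge if $h=gm$ or $g=hm$ for some $m\in M$; the distance of two vertices is the length of a shortest edge path. Let $\mathcal D_\Gamma$ be the Deligne complex, i.e. the simplicial complex whose simplices are the finite nonempty chains (under inclusion) of cosets $gA_T$ with $g\in A_\Gamma$ and $T\subseteq X$ of spherical type ($T=\emptyset$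 allowed). Let $\mathcal D_\Gamma^+$ be the subcomplex of the simplices all of whose vertices are of the form $mA_T$ with $m\in M$. The group $A_\Gamma$ acts on $\mathcal D_\Gamma$ by left multiplication. The coned-off Deligne complex $C\mathcal D_\Gamma$ is the simplicial complex obtained from $\mathcal D_\Gamma$ by adding, for every $g\in A_\Gamma$, a vertex $v_g$ and the simplex $v_g*\sigma$ for every simplex $\sigma$ of the translate $g\mathcal D_\Gamma^+$. Its geometric realization carries the piecewise Euclidean path metric in which every simplex is a regular Euclidean simplex with all edges of length $1$. Then all distances in $\mathrm{Cay}(A_\Gamma,M)$ and in $C\mathcal D_\Gamma$ are finite, and the map $g\mapsto v_g$ from the vertices of $\mathrm{Cay}(A_\Gamma,M)$ to $C\mathcal D_\Gamma$ is a quasi-isometry: there are constants $A\ge 1$ and $C\ge 0$ such that $$\tfrac1A\,d_{\mathrm{Cay}}(g,h)-C\;\le\; d_{C\mathcal D_\Gamma}(v_g,v_h)\;\le\; A\,d_{\mathrm{Cay}}(g,h)+C\qquad\text{for all } g,h\in A_\Gamma,$$ and every point of $C\mathcal D_\Gamma$ is at distance at most $C$ from some $v_g$. -/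

import Mathlib

open scoped ENNReal NNReal Pointwise

/-! ### Path metrics, realizations of simplicial complexes, quasi-isometries -/

/-- A map `f` is a quasi-isometry if, for some constants `A ≥ 1` and `C ≥ 0`,
`A⁻¹ d(x, y) - C ≤ d(f x, f y) ≤ A d(x, y) + C` for all `x`, `y`, and every point of the target is
within distance `C` of the image. -/
def IsQuasiIsometry {X Y : Type*} [PseudoEMetricSpace X] [PseudoEMetricSpace Y] (f : X → Y) :
    Prop :=
  ∃ A C : ℝ≥0, 1 ≤ A ∧
    (∀ x y : X, edist (f x) (f y) ≤ A * edist x y + C ∧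
      ((A⁻¹ : ℝ≥0) : ℝ≥0∞) * edist x y ≤ edist (f x) (f y) + C) ∧
    ∀ p : Y, ∃ x : X, edist p (f x) ≤ C

/-- The vertex set of a graph, as a type that carries the path metric of the graph. -/
structure GraphVertex {V : Type*} (G : SimpleGraph V) where
  /-- The underlying vertex. -/
  val : V

/-- The distance of two vertices is the length of a shortest edge path between them. -/
noncomputable instance {V : Type*} (G : SimpleGraph V) : PseudoEMetricSpace (GraphVertex G) where
  edist u v := ((G.edist u.val v.val : ℕ∞) : ℝ≥0∞)
  edist_self u := by simp
  edist_comm u v := by rw [SimpleGraph.edist_comm]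
  edist_triangle u v w := by
    rw [← ENat.toENNReal_add]
    exact ENat.toENNReal_mono SimpleGraph.edist_triangle

namespace AbstractSimplicialComplex

variable {V : Type*}

/-- The set of points of the geometric realization of `K`: finitely supported families of
barycentric coordinates whose support is a simplex of `K`. -/
def Realization (K : AbstractSimplicialComplex V) : Type _ :=
  {x : V →₀ ℝ // (∀ v, 0 ≤ x v) ∧ (x.sum fun _ r => r) = 1 ∧ x.support ∈ K.faces}

namespace Realization

variable {K : AbstractSimplicialComplex V}

/-- The point of the realization given by a vertex. -/
noncomputable def vertex (K : AbstractSimplicialComplex V) (v : V) : K.Realization :=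
  ⟨Finsupp.single v 1, by
    refine ⟨fun w => ?_, by simp, ?_⟩
    · classical
      rw [Finsupp.single_apply]
      split_ifs <;> norm_num
    · rw [Finsupp.support_single _ one_ne_zero]
      exact K.singleton_mem v⟩

/-- Both points lie in one closed simplex of `K`. -/
def InCommonSimplex (x y : K.Realization) : Prop :=
  ∃ s ∈ K.faces, x.1.support ⊆ s ∧ y.1.support ⊆ s

/-- The distance of two points of a common simplex, for the Euclidean metric on that simplex in
which it is regular with all edges of length `1`: `d(x, y)² = (1/2) ∑ (x_v - y_v)²`. -/
noncomputable def simplexDist (x y : K.Realization) : ℝ :=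
  Real.sqrt ((1 / 2) * (x.1 - y.1).sum fun _ r => r ^ 2)

/-- `c 0, …, c n` is a string from `x` to `y`: consecutive points lie in a common simplex. -/
def IsString (x y : K.Realization) (n : ℕ) (c : ℕ → K.Realization) : Prop :=
  c 0 = x ∧ c n = y ∧ ∀ i < n, InCommonSimplex (c i) (c (i + 1))

/-- The length of the string `c 0, …, c n`. -/
noncomputable def stringLength (n : ℕ) (c : ℕ → K.Realization) : ℝ≥0∞ :=
  ∑ i ∈ Finset.range n, ENNReal.ofReal (simplexDist (c i) (c (i + 1)))

/-- The piecewise Euclidean distance: the infimum of the lengths of all strings between the two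
points. -/
noncomputable def pathDist (x y : K.Realization) : ℝ≥0∞ :=
  ⨅ (n : ℕ) (c : ℕ → K.Realization) (_ : IsString x y n c), stringLength n c

theorem simplexDist_comm (x y : K.Realization) : simplexDist x y = simplexDist y x := by
  unfold simplexDist
  rw [← neg_sub y.1 x.1, Finsupp.sum_neg_index (by simp)]
  simp

theorem pathDist_le {x y : K.Realization} {n : ℕ} {c : ℕ → K.Realization}
    (h : IsString x y n c) : pathDist x y ≤ stringLength n c :=
  iInf_le_of_le n (iInf_le_of_le c (iInf_le _ h))

theorem pathDist_comm_le (x y : K.Realization) : pathDist x y ≤ pathDist y x := by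
  refine le_iInf fun n => le_iInf fun c => le_iInf fun h => ?_
  have key : IsString x y n (fun i => c (n - i)) := by
    refine ⟨by simpa using h.2.1, by simpa using h.1, fun i hi => ?_⟩
    obtain ⟨s, hs, h1, h2⟩ := h.2.2 (n - (i + 1)) (by omega)
    have e : n - (i + 1) + 1 = n - i := by omega
    rw [e] at h2
    exact ⟨s, hs, h2, h1⟩
  refine (pathDist_le key).trans (le_of_eq ?_)
  unfold stringLength
  rw [← Finset.sum_range_reflect]
  refine Finset.sum_congr rfl fun i hi => ?_
  have hi' := Finset.mem_range.1 hi
  have e1 : n - (n - 1 - i) = i + 1 := by omega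
  have e2 : n - (n - 1 - i + 1) = i := by omega
  simp only [e1, e2]
  rw [simplexDist_comm]

theorem pathDist_triangle (x y z : K.Realization) :
    pathDist x z ≤ pathDist x y + pathDist y z := by
  unfold pathDist
  simp only [ENNReal.iInf_add, ENNReal.add_iInf]
  refine le_iInf fun m => le_iInf fun d => le_iInf fun k => ?_
  refine le_iInf fun n => le_iInf fun c => le_iInf fun h => ?_
  have key : IsString x z (n + m) (fun i => if i ≤ n then c i else d (i - n)) := by
    refine ⟨by simpa using h.1, ?_, fun i hi => ?_⟩
    · rcases Nat.eq_zero_or_pos m with rfl | hm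
      · simpa [h.2.1, ← k.1] using k.2.1
      · simpa [hm.ne'] using k.2.1
    · rcases lt_trichotomy i n with hin | rfl | hin
      · simpa [hin.le, Nat.succ_le_of_lt hin] using h.2.2 i hin
      · have := k.2.2 0 (by omega)
        simpa [h.2.1, ← k.1] using this
      · have := k.2.2 (i - n) (by omega)
        have e : i - n + 1 = i + 1 - n := by omega
        simpa [hin.not_ge, show ¬ i + 1 ≤ n by omega, e] using this
  refine (pathDist_le key).trans (le_of_eq ?_)
  unfold stringLength
  rw [Finset.sum_range_add]
  congr 1
  · refine Finset.sum_congr rfl fun i hi => ?_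
    have hi' := Finset.mem_range.1 hi
    simp [hi'.le, Nat.succ_le_of_lt hi']
  · refine Finset.sum_congr rfl fun i _ => ?_
    rcases Nat.eq_zero_or_pos i with rfl | hi
    · simp [h.2.1, ← k.1]
    · simp [hi.ne', show n + i + 1 - n = i + 1 by omega, show ¬ n + i + 1 ≤ n by omega]

noncomputable instance : PseudoEMetricSpace K.Realization where
  edist := pathDist
  edist_self x := by
    have h : IsString x x 0 (fun _ => x) := ⟨rfl, rfl, by simp⟩
    simpa [stringLength] using pathDist_le h
  edist_comm x y := le_antisymm (pathDist_comm_le x y) (pathDist_comm_le y x)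
  edist_triangle := pathDist_triangle

end Realization

end AbstractSimplicialComplex

/-! ### Artin groups

The defining graph is encoded by its Coxeter matrix `M` on the vertex set `B`: `M i j ≥ 2` is the
label of the edge between `i ≠ j`, and `M i j = 0` means that there is no edge (label `∞`). -/

namespace CoxeterMatrix

variable {B : Type*} (M : CoxeterMatrix B)

/-- The word `⋯ x_j x_i x_j` of length `m` in the free group. -/
def artinWord (i j : B) (m : ℕ) : FreeGroup B :=
  ((CoxeterSystem.alternatingWord i j m).map FreeGroup.of).prod

/-- The Artin relators: for every edge `{i, j}`, the two alternating words of length `M i j` in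
`x_i` and `x_j` are identified. -/
def artinRelators : Set (FreeGroup B) :=
  {r | ∃ i j : B, i ≠ j ∧ M i j ≠ 0 ∧ r = artinWord i j (M i j) * (artinWord j i (M i j))⁻¹}

/-- The Artin group. -/
abbrev ArtinGroup : Type _ := PresentedGroup M.artinRelators

/-- The standard generators of the Artin group. -/
def artinGen (i : B) : M.ArtinGroup := PresentedGroup.of i

/-- The Artin monoid, as the submonoid of positive words of the Artin group. -/
def artinMonoid : Submonoid M.ArtinGroup := Submonoid.closure (Set.range M.artinGen)

/-- The special subgroup generated by a set `T` of standard generators. -/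
def specialSubgroup (T : Set B) : Subgroup M.ArtinGroup := Subgroup.closure (M.artinGen '' T)

/-- The Coxeter matrix of the full labelled subgraph spanned by `T`. -/
def restrict (T : Set B) : CoxeterMatrix T where
  M := Matrix.of fun i j => M i.1 j.1
  isSymm := Matrix.IsSymm.ext fun i j => M.symmetric j.1 i.1
  diagonal i := M.diagonal i.1
  off_diagonal i j h := M.off_diagonal i.1 j.1 fun e => h (Subtype.ext e)

/-- Spherical type: the Coxeter group is finite. -/
def IsSpherical : Prop := Finite M.Group

/-- Infinite type: the Coxeter group is infinite. -/
def IsInfiniteType : Prop := Infinite M.Group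

/-! ### The Deligne complex and the coned-off Deligne complex -/

/-- The poset (under inclusion) of the cosets `g A_T` of spherical type special subgroups. -/
abbrev DeligneVertex : Type _ :=
  {S : Set M.ArtinGroup //
    ∃ (g : M.ArtinGroup) (T : Set B), (M.restrict T).IsSpherical ∧
      S = g • (M.specialSubgroup T : Set M.ArtinGroup)}

/-- The action of the Artin group on the cosets by left multiplication. -/
instance : SMul M.ArtinGroup M.DeligneVertex where
  smul h c := ⟨h • c.1, by
    obtain ⟨g, T, hT, e⟩ := c.2
    exact ⟨h * g, T, hT, by rw [e, smul_smul]⟩⟩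

/-- The Deligne complex: its simplices are the finite nonempty chains of cosets. -/
def deligneComplex : AbstractSimplicialComplex M.DeligneVertex where
  faces := {s | s.Nonempty ∧ IsChain (· ≤ ·) (s : Set M.DeligneVertex)}
  isRelLowerSet_faces := fun _ hs =>
    ⟨hs.1, fun _ hts ht => ⟨ht, hs.2.mono (Finset.coe_subset.2 hts)⟩⟩
  singleton_mem v := ⟨Finset.singleton_nonempty v, by simp⟩

/-- The monoid Deligne complex: the simplices of the Deligne complex all of whose vertices are
cosets `m A_T` with `m` in the Artin monoid. -/
def monoidDeligneComplex : PreAbstractSimplicialComplex M.DeligneVertex where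
  faces := {s | s ∈ M.deligneComplex.faces ∧ ∀ c ∈ s, ∃ m ∈ M.artinMonoid, ∃ T : Set B,
    (M.restrict T).IsSpherical ∧ c.1 = m • (M.specialSubgroup T : Set M.ArtinGroup)}
  isRelLowerSet_faces := fun _ hs =>
    ⟨hs.1.1, fun _ hts ht =>
      ⟨(M.deligneComplex.isRelLowerSet_faces hs.1).2 hts ht, fun c hc => hs.2 c (hts hc)⟩⟩

open Classical in
/-- The translate of the monoid Deligne complex by `g`. -/
noncomputable def translate (g : M.ArtinGroup) : PreAbstractSimplicialComplex M.DeligneVertex :=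
  M.monoidDeligneComplex.map (g • ·)

theorem translate_le (g : M.ArtinGroup) : (M.translate g).faces ⊆ M.deligneComplex.faces := by
  classical
  rintro s ⟨t, ht, rfl⟩
  refine ⟨ht.1.1.image _, ?_⟩
  rw [Finset.coe_image]
  rintro _ ⟨a, ha, rfl⟩ _ ⟨b, hb, rfl⟩ _
  rcases ht.1.2.total ha hb with h | h
  · exact Or.inl (Set.smul_set_mono h)
  · exact Or.inr (Set.smul_set_mono h)

/-- The coned-off Deligne complex. Its vertices are the vertices of the Deligne complex
(`Sum.inl`) and one cone vertex `v_g` for every `g` (`Sum.inr`). Its simplices are those of the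
Deligne complex, the cone vertices, and the joins `v_g * σ` with `σ` a simplex of the translate of
the monoid Deligne complex by `g`. -/
def conedOffDeligneComplex : AbstractSimplicialComplex (M.DeligneVertex ⊕ M.ArtinGroup) where
  faces := {s | (s.toRight = ∅ ∧ s.toLeft ∈ M.deligneComplex.faces) ∨
    ∃ g, s.toRight = {g} ∧ (s.toLeft = ∅ ∨ s.toLeft ∈ (M.translate g).faces)}
  isRelLowerSet_faces := by
    have key : ∀ s : Finset (M.DeligneVertex ⊕ M.ArtinGroup), s.Nonempty ↔
        s.toLeft.Nonempty ∨ s.toRight.Nonempty := by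
      intro s
      simp [Finset.Nonempty, Sum.exists]
    intro s hs
    refine ⟨?_, fun t hts ht => ?_⟩
    · rw [key]
      rcases hs with ⟨_, h⟩ | ⟨g, h, _⟩
      · exact Or.inl (M.deligneComplex.isRelLowerSet_faces h).1
      · exact Or.inr (by rw [h]; exact Finset.singleton_nonempty g)
    · have hl : t.toLeft ⊆ s.toLeft := Finset.toLeft_subset_toLeft hts
      have hr : t.toRight ⊆ s.toRight := Finset.toRight_subset_toRight hts
      rcases t.toRight.eq_empty_or_nonempty with h0 | h0
      · have hne : t.toLeft.Nonempty := by
          rcases (key t).1 ht with h | h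
          · exact h
          · simp [h0] at h
        refine Or.inl ⟨h0, ?_⟩
        rcases hs with ⟨_, h⟩ | ⟨g, _, h | h⟩
        · exact (M.deligneComplex.isRelLowerSet_faces h).2 hl hne
        · rw [h, Finset.subset_empty] at hl
          simp [hl] at hne
        · exact (M.deligneComplex.isRelLowerSet_faces (M.translate_le g h)).2 hl hne
      · rcases hs with ⟨h, _⟩ | ⟨g, hg, h⟩
        · rw [h, Finset.subset_empty] at hr
          simp [hr] at h0
        · rw [hg] at hr
          refine Or.inr ⟨g, (Finset.subset_singleton_iff.1 hr).resolve_left h0.ne_empty, ?_⟩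
          rcases t.toLeft.eq_empty_or_nonempty with h1 | h1
          · exact Or.inl h1
          · rcases h with h | h
            · rw [h, Finset.subset_empty] at hl
              exact Or.inl hl
            · exact Or.inr (((M.translate g).isRelLowerSet_faces h).2 hl h1)
  singleton_mem v := by
    rcases v with c | g
    · have e1 : ({Sum.inl c} : Finset (M.DeligneVertex ⊕ M.ArtinGroup)).toRight = ∅ := by
        ext; simp
      have e2 : ({Sum.inl c} : Finset (M.DeligneVertex ⊕ M.ArtinGroup)).toLeft = {c} := by
        ext; simp
      exact Or.inl ⟨e1, e2 ▸ M.deligneComplex.singleton_mem c⟩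
    · exact Or.inr ⟨g, by ext; simp, Or.inl (by ext; simp)⟩

/-- The map from the vertex set of the monoid Cayley graph `Cay(A, A⁺)`, with its path metric, to
the coned-off Deligne complex that sends `g` to the cone vertex `v_g`. -/
noncomputable def coneVertexMap :
    GraphVertex (SimpleGraph.mulCayley (M.artinMonoid : Set M.ArtinGroup)) →
      M.conedOffDeligneComplex.Realization :=
  fun g => AbstractSimplicialComplex.Realization.vertex M.conedOffDeligneComplex
    (Sum.inr g.val)

end CoxeterMatrix

/-! ### The geometric representation of a Coxeter group -/

namespace CoxeterMatrix

variable {B : Type*} (M : CoxeterMatrix B)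

/-! Both inequalities come from comparing adjacent vertices. An edge `g — gm` of the Cayley graph
becomes a path of length at most 2: the vertex `{gm}`, a coset of the trivial subgroup, lies in both
cones and is joined to `v_g` and `v_{gm}`.

Conversely, choose an element of every coset and let `v_g` be represented by `g`. The key point is
that a coset of a spherical `A_T` has diameter at most 2 in the Cayley graph, because every element
of `A_T` is a fraction `b⁻¹c` of positive elements (`exists_inv_mul_eq_of_mem_specialSubgroup`).
Hence the representatives of two vertices of one simplex are at distance at most 3. Since the
dimension is bounded, the function `d(g, ·)` on representatives, extended affinely over simplices,
is Lipschitz (`lipschitzWith_affineExtension`), and it takes the values 0 at `v_g` and `d(g, h)` at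
`v_h`.

The fractions come from Garside's argument. The longest element of the finite Coxeter group lifts to
a positive `Δ` that every generator divides and that permutes the generators by conjugation
(`exists_garside_element`). The lift is well defined by `matsumoto`, which rests on the exchange
property (`simple_mem_rightInvSeq`) and on the exact orders of the products `s_i s_j`, read off the
geometric representation. It is enough that the generators of `A_T` satisfy the braid relations of
`T`; no presentation of `A_T` is needed. -/

/-- The coroot functional `α_j ↦ 2 B(α_i, α_j) = -2 cos (π / M i j)`. -/
noncomputable def simpleCoroot (i : B) : Module.Dual ℝ (B →₀ ℝ) :=
  Finsupp.linearCombination ℝ fun j => -2 * Real.cos (Real.pi / M i j)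

/-- The label ∞ is encoded by `M i j = 0`; as `π / 0 = 0`, it gives the value `-2`, as it should. -/
theorem simpleCoroot_single (i j : B) :
    M.simpleCoroot i (Finsupp.single j 1) = -2 * Real.cos (Real.pi / M i j) := by
  simp [simpleCoroot]

theorem simpleCoroot_self (i : B) : M.simpleCoroot i (Finsupp.single i 1) = 2 := by
  simp [simpleCoroot_single]

/-- The reflection of the geometric representation in a simple root. -/
noncomputable def simpleReflection (i : B) : (B →₀ ℝ) ≃ₗ[ℝ] (B →₀ ℝ) :=
  Module.reflection (M.simpleCoroot_self i)

/-- This is the trace of `r_i r_j` on the plane of the two roots, a rotation by `2π/m`. It is the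
argument of the Chebyshev polynomials `S` that express powers of `r_i r_j`. -/
theorem simpleCoroot_mul_sub_two (i j : B) :
    M.simpleCoroot i (Finsupp.single j 1) * M.simpleCoroot j (Finsupp.single i 1) - 2 =
      2 * Real.cos (2 * (Real.pi / M i j)) := by
  rw [simpleCoroot_single, simpleCoroot_single, M.symmetric j i, Real.cos_two_mul]
  ring

theorem sin_two_pi_div_pos {m : ℕ} (hm : 3 ≤ m) : 0 < Real.sin (2 * (Real.pi / m)) := by
  have hm' : (3 : ℝ) ≤ m := by exact_mod_cast hm
  have h : Real.pi / m ≤ Real.pi / 3 := by gcongr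
  have h' : 0 < Real.pi / m := by positivity
  exact Real.sin_pos_of_pos_of_lt_pi (by linarith) (by linarith [Real.pi_pos])

theorem isLiftable_simpleReflection : M.IsLiftable M.simpleReflection := by
  intro i j
  obtain h0 | h1 | h2 | h3 : M i j = 0 ∨ M i j = 1 ∨ M i j = 2 ∨ 3 ≤ M i j := by omega
  · simp [h0]
  · have hij : i = j := by_contra fun h => M.off_diagonal i j h h1
    subst hij
    rw [h1, pow_one, mul_eq_one_iff_eq_inv, simpleReflection, Module.reflection_inv]
  · have e1 : M.simpleCoroot i (Finsupp.single j 1) = 0 := by simp [simpleCoroot_single, h2]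
    have e2 : M.simpleCoroot j (Finsupp.single i 1) = 0 := by
      simp [simpleCoroot_single, M.symmetric j i, h2]
    rw [h2]
    refine LinearEquiv.ext fun z => ?_
    simp only [pow_two, LinearEquiv.mul_apply, simpleReflection, Module.reflection_apply, map_sub,
      map_smul, e1, e2, simpleCoroot_self, LinearEquiv.coe_one, id]
    module
  · refine LinearEquiv.ext fun z => ?_
    rw [simpleReflection, simpleReflection,
      Module.reflection_mul_reflection_pow_apply _ _ _ _ _ (M.simpleCoroot_mul_sub_two i j).symm]
    have hs := (sin_two_pi_div_pos h3).ne'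
    have hm : (M i j : ℝ) ≠ 0 := by
      have : M i j ≠ 0 := by omega
      exact_mod_cast this
    have key := fun n : ℤ => Polynomial.Chebyshev.S_two_mul_real_cos (2 * (Real.pi / M i j)) n
    generalize Finsupp.single i (1 : ℝ) = x
    generalize Finsupp.single j (1 : ℝ) = y
    set t := 2 * Real.cos (2 * (Real.pi / M i j)) with ht
    -- With `φ = 2π/m`, `S_n(2 cos φ) sin φ = sin((n+1)φ)`. For `m = 2p`, `pφ = π` gives `S_{p-1} =
    -- 0`; for `m = 2p+1`, `pφ + (p+1)φ = 2π` gives `S_p + S_{p-1} = 0`. Every nontrivial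
    -- coefficient contains this factor.
    rcases Nat.even_or_odd' (M i j) with ⟨p, hp | hp⟩
    · have hp0 : (p : ℝ) ≠ 0 := by
        have : p ≠ 0 := by omega
        exact_mod_cast this
      have e1 : ((M i j : ℤ) - 2) / 2 = p - 1 := by omega
      have e2 : ((M i j : ℤ) - 1) / 2 = p - 1 := by omega
      have hz : (Polynomial.Chebyshev.S ℝ ((p : ℤ) - 1)).eval t = 0 := by
        have := key ((p : ℤ) - 1)
        have e : (((p : ℤ) - 1 : ℤ) + 1 : ℝ) * (2 * (Real.pi / M i j)) = Real.pi := by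
          push_cast
          rw [hp]
          push_cast
          field_simp
          ring
        rw [e, Real.sin_pi] at this
        exact (mul_eq_zero.1 this).resolve_right hs
      rw [e1, e2, hz]
      simp
    · have e1 : ((M i j : ℤ) - 2) / 2 = p - 1 := by omega
      have e2 : ((M i j : ℤ) - 1) / 2 = p := by omega
      have e3 : ((M i j : ℤ) - 3) / 2 = p - 1 := by omega
      have e4 : (M i j : ℤ) / 2 = p := by omega
      have hz : (Polynomial.Chebyshev.S ℝ (p : ℤ)).eval t +
          (Polynomial.Chebyshev.S ℝ ((p : ℤ) - 1)).eval t = 0 := by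
        have h1 := key (p : ℤ)
        have h2 := key ((p : ℤ) - 1)
        have e : (((p : ℤ) : ℝ) + 1) * (2 * (Real.pi / M i j)) =
            2 * Real.pi - (((p : ℤ) - 1 : ℤ) + 1 : ℝ) * (2 * (Real.pi / M i j)) := by
          push_cast
          rw [hp] at hm ⊢
          push_cast at hm ⊢
          field_simp
          ring
        rw [e, Real.sin_two_pi_sub] at h1
        have : ((Polynomial.Chebyshev.S ℝ (p : ℤ)).eval t +
          (Polynomial.Chebyshev.S ℝ ((p : ℤ) - 1)).eval t) * Real.sin (2 * (Real.pi / M i j)) =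
            0 := by linarith
        exact (mul_eq_zero.1 this).resolve_right hs
      rw [e1, e2, e3, e4, hz]
      simp

/-- Apply the power to `α_i`: if it were the identity, the coordinates would give `S_k + S_{k-1} =
1` and `S_{k-1} cos(π/m) = 0`. The second fails for `m = 0`, where `S_{k-1}(2) = k`; the first fails
for `m = 2`, `k = 1`. -/
theorem simpleReflection_mul_pow_ne_one {i j : B} (hij : i ≠ j) {k : ℕ} (hk : 0 < k)
    (hkm : k < M i j ∨ M i j = 0) : (M.simpleReflection i * M.simpleReflection j) ^ k ≠ 1 := by
  intro h
  have key := Module.reflection_mul_reflection_pow_apply_self (M.simpleCoroot_self i)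
    (M.simpleCoroot_self j) k _ (M.simpleCoroot_mul_sub_two i j).symm
  rw [← simpleReflection, ← simpleReflection, h, LinearEquiv.coe_one, id] at key
  have h1 := DFunLike.congr_fun key i
  have h2 := DFunLike.congr_fun key j
  simp only [Finsupp.add_apply, Finsupp.smul_apply, Finsupp.single_eq_same,
    Finsupp.single_eq_of_ne hij, Finsupp.single_eq_of_ne hij.symm, smul_eq_mul, mul_one, mul_zero,
    add_zero, zero_add, simpleCoroot_single, M.symmetric j i] at h1 h2
  have hM1 := M.off_diagonal i j hij
  obtain h0 | h2' | h3 : M i j = 0 ∨ M i j = 2 ∨ 3 ≤ M i j := by omega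
  · rw [h0] at h2
    simp [Polynomial.Chebyshev.S_eval_two] at h2
    omega
  · obtain rfl : k = 1 := by omega
    rw [h2'] at h1
    norm_num [mul_div_cancel₀] at h1
  · have hs := (sin_two_pi_div_pos h3).ne'
    have hm : (M i j : ℝ) ≠ 0 := by
      have : M i j ≠ 0 := by omega
      exact_mod_cast this
    have hc : 0 < Real.cos (Real.pi / M i j) := by
      have hm' : (3 : ℝ) ≤ M i j := by exact_mod_cast h3
      have h : Real.pi / M i j ≤ Real.pi / 3 := by gcongr
      have h' : 0 < Real.pi / M i j := by positivity
      exact Real.cos_pos_of_mem_Ioo ⟨by linarith [Real.pi_pos], by linarith [Real.pi_pos]⟩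
    have hS : (Polynomial.Chebyshev.S ℝ ((k : ℤ) - 1)).eval
        (2 * Real.cos (2 * (Real.pi / M i j))) = 0 := by
      have hne : -(-2 * Real.cos (Real.pi / M i j)) ≠ 0 := by linarith [hc.ne']
      exact (mul_eq_zero.1 h2.symm).resolve_right hne
    have hS1 := Polynomial.Chebyshev.S_two_mul_real_cos (2 * (Real.pi / M i j)) ((k : ℤ) - 1)
    have hS2 := Polynomial.Chebyshev.S_two_mul_real_cos (2 * (Real.pi / M i j)) (k : ℤ)
    rw [hS, zero_mul] at hS1
    rw [hS, add_zero] at h1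
    rw [← h1] at hS2
    push_cast at hS1 hS2
    rw [sub_add_cancel] at hS1
    obtain ⟨n, hn⟩ := Real.sin_eq_zero_iff.1 hS1.symm
    have hn' : n * (M i j : ℤ) = 2 * k := by
      have : (n : ℝ) * M i j = 2 * k := by
        have hpi := Real.pi_ne_zero
        field_simp at hn
        linarith
      exact_mod_cast this
    have hkm' : k < M i j := by omega
    -- From `S_{k-1} = 0`, `kφ = nπ` with `nm = 2k`, and `0 < k < m` forces `kφ = π`. Then
    -- `sin((k+1)φ) = -sin φ`, whereas `S_k = 1` makes it `sin φ`.
    have hn1 : n = 1 := by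
      have h1 : 0 < n := by
        by_contra hneg
        have : n * (M i j : ℤ) ≤ 0 :=
          mul_nonpos_of_nonpos_of_nonneg (by omega) (by omega)
        omega
      have h2 : n < 2 := by
        by_contra hneg
        have : 2 * (M i j : ℤ) ≤ n * (M i j : ℤ) :=
          mul_le_mul_of_nonneg_right (by omega) (by omega)
        omega
      omega
    rw [hn1, Int.cast_one, one_mul] at hn
    rw [add_mul, ← hn, one_mul, Real.sin_add, Real.sin_pi, Real.cos_pi] at hS2
    apply hs
    rw [one_mul] at hS2
    linarith

end CoxeterMatrix

namespace CoxeterSystem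

variable {B W : Type*} [Group W] {M : CoxeterMatrix B} (cs : CoxeterSystem M W)

theorem simple_mul_simple_pow_ne_one {i j : B} (hij : i ≠ j) {k : ℕ} (hk : 0 < k)
    (hkm : k < M i j ∨ M i j = 0) : (cs.simple i * cs.simple j) ^ k ≠ 1 := by
  intro h
  apply M.simpleReflection_mul_pow_ne_one hij hk hkm
  simpa [cs.lift_apply_simple M.isLiftable_simpleReflection] using
    congrArg (cs.lift ⟨M.simpleReflection, M.isLiftable_simpleReflection⟩) h

end CoxeterSystem

/-! ### The exchange property -/

namespace CoxeterSystem

open List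

variable {B W : Type*} [Group W] {M : CoxeterMatrix B} (cs : CoxeterSystem M W)

theorem functionEnd_mul_apply {X : Type*} (f g : Function.End X) (x : X) :
    (f * g) x = f (g x) := rfl

open Classical in
/-- The action of a simple reflection `s` on pairs of an element `t` and a sign: `t` is conjugated,
and the sign changes if `t = s`. -/
noncomputable def signedConj (i : B) : Function.End (W × ZMod 2) := fun x =>
  (cs.simple i * x.1 * cs.simple i, x.2 + if x.1 = cs.simple i then 1 else 0)

theorem simple_conj_pow (i j : B) (k : ℕ) :
    cs.simple j * (cs.simple i * cs.simple j) ^ k * cs.simple j =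
      ((cs.simple i * cs.simple j) ^ k)⁻¹ := by
  have h : cs.simple j * (cs.simple i * cs.simple j) * (cs.simple j)⁻¹ =
      (cs.simple i * cs.simple j)⁻¹ := by simp [mul_assoc]
  rw [← inv_pow, ← h, conj_pow, inv_simple]

theorem pow_inv_mul_simple (i j : B) (k : ℕ) :
    ((cs.simple i * cs.simple j) ^ k)⁻¹ * cs.simple j =
      cs.simple j * (cs.simple i * cs.simple j) ^ k := by
  rw [← simple_conj_pow, simple_mul_simple_cancel_right]

theorem inv_pow_mul_simple_mul_pow (i j : B) (k : ℕ) :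
    ((cs.simple i * cs.simple j) ^ k)⁻¹ * cs.simple j * (cs.simple i * cs.simple j) ^ k =
      cs.simple j * (cs.simple i * cs.simple j) ^ (2 * k) := by
  rw [pow_inv_mul_simple, mul_assoc, ← pow_add, two_mul]

theorem inv_pow_mul_simple_mul_simple_mul_simple_mul_pow (i j : B) (k : ℕ) :
    ((cs.simple i * cs.simple j) ^ k)⁻¹ * (cs.simple j * cs.simple i * cs.simple j) *
        (cs.simple i * cs.simple j) ^ k =
      cs.simple j * (cs.simple i * cs.simple j) ^ (2 * k + 1) := by
  rw [mul_assoc (cs.simple j), ← mul_assoc, pow_inv_mul_simple, mul_assoc, mul_assoc, ← pow_succ',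
    ← pow_add]
  congr 2
  omega

open Classical in
theorem signedConj_mul_pow_apply (i j : B) (k : ℕ) (t : W) (ε : ZMod 2) :
    ((cs.signedConj i * cs.signedConj j) ^ k) (t, ε) =
      ((cs.simple i * cs.simple j) ^ k * t * ((cs.simple i * cs.simple j) ^ k)⁻¹,
        ε + ∑ l ∈ Finset.range (2 * k),
          if t = cs.simple j * (cs.simple i * cs.simple j) ^ l then 1 else 0) := by
  induction k with
  | zero => simp [Function.End.one_def]
  | succ k ih =>
    have e1 : (cs.simple i * cs.simple j) ^ k * t * ((cs.simple i * cs.simple j) ^ k)⁻¹ =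
        cs.simple j ↔ t = cs.simple j * (cs.simple i * cs.simple j) ^ (2 * k) := by
      rw [← inv_pow_mul_simple_mul_pow, mul_inv_eq_iff_eq_mul, mul_assoc, eq_inv_mul_iff_mul_eq]
    have e2 : cs.simple j * ((cs.simple i * cs.simple j) ^ k * t *
        ((cs.simple i * cs.simple j) ^ k)⁻¹) * cs.simple j = cs.simple i ↔
        t = cs.simple j * (cs.simple i * cs.simple j) ^ (2 * k + 1) := by
      rw [← inv_pow_mul_simple_mul_simple_mul_simple_mul_pow, mul_assoc _ _ (_ ^ k),
        eq_inv_mul_iff_mul_eq, ← mul_inv_eq_iff_eq_mul]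
      generalize (cs.simple i * cs.simple j) ^ k * t * ((cs.simple i * cs.simple j) ^ k)⁻¹ = x
      constructor
      · intro h
        simp [← h, mul_assoc]
      · rintro rfl
        simp [mul_assoc]
    rw [pow_succ', functionEnd_mul_apply, ih, functionEnd_mul_apply]
    simp only [signedConj, e1, e2]
    refine Prod.ext ?_ ?_
    · simp [pow_succ', mul_assoc]
    · rw [show 2 * (k + 1) = 2 * k + 1 + 1 by ring, Finset.sum_range_succ, Finset.sum_range_succ]
      simp only [add_assoc]

/-- The sign changes along `(s_i s_j)^m` are indexed by `l < 2m`; the conditions for `l` and `l + m`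
agree, so they cancel modulo 2. -/
theorem isLiftable_signedConj : M.IsLiftable cs.signedConj := by
  classical
  intro i j
  funext ⟨t, ε⟩
  rw [signedConj_mul_pow_apply, simple_mul_simple_pow, two_mul, Finset.sum_range_add]
  simp only [pow_add, simple_mul_simple_pow, one_mul]
  rw [CharTwo.add_self_eq_zero]
  simp [Function.End.one_def]

-- Consequently the parity of the number of occurrences of `t` in the right inversion sequence
-- depends only on the group element, not on the word.
open Classical in
theorem lift_signedConj_wordProd (ω : List B) (t : W) (ε : ZMod 2) :
    cs.lift ⟨cs.signedConj, cs.isLiftable_signedConj⟩ (cs.wordProd ω) (t, ε) =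
      (cs.wordProd ω * t * (cs.wordProd ω)⁻¹, ε + (cs.rightInvSeq ω).count t) := by
  induction ω with
  | nil => simp [Function.End.one_def]
  | cons i ω ih =>
    rw [wordProd_cons, map_mul, lift_apply_simple, functionEnd_mul_apply, ih]
    simp only [signedConj, rightInvSeq, count_cons, beq_iff_eq]
    refine Prod.ext ?_ ?_
    · simp [mul_assoc]
    · have : cs.wordProd ω * t * (cs.wordProd ω)⁻¹ = cs.simple i ↔
          (cs.wordProd ω)⁻¹ * cs.simple i * cs.wordProd ω = t := by
        rw [mul_inv_eq_iff_eq_mul, ← eq_inv_mul_iff_mul_eq, mul_assoc, eq_comm]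
      simp only [this]
      push_cast
      simp only [add_assoc]

/-- The exchange property. -/
theorem simple_mem_rightInvSeq {ω : List B} {i : B} (h : cs.IsRightDescent (cs.wordProd ω) i) :
    cs.simple i ∈ cs.rightInvSeq ω := by
  classical
  obtain ⟨ω', hω', e⟩ := cs.exists_isReduced (cs.wordProd ω * cs.simple i)
  have e' : cs.wordProd ω = cs.wordProd (ω' ++ [i]) := by
    rw [wordProd_append, ← e]
    simp
  -- Otherwise right multiplication by `s_i` would shorten `w s_i` to `w`, against the descent.
  have hnot : cs.simple i ∉ cs.rightInvSeq ω' := fun hmem => by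
    have := (cs.isRightInversion_of_mem_rightInvSeq hω' hmem).2
    rw [← e, simple_mul_simple_cancel_right] at this
    exact lt_asymm this h
  -- Compare parities for two words of the same element: `s_i` occurs exactly once for `ω' ++ [i]`,
  -- hence an odd number of times for `ω`.
  have h1 := cs.lift_signedConj_wordProd ω (cs.simple i) 0
  have h2 := cs.lift_signedConj_wordProd (ω'.concat i) (cs.simple i) 0
  rw [concat_eq_append, ← e', h1, ← concat_eq_append, rightInvSeq_concat] at h2
  have h3 := congrArg Prod.snd h2
  have h4 : count (cs.simple i) (List.map (MulAut.conj (cs.simple i)) (cs.rightInvSeq ω')) = 0 := by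
    rw [count_eq_zero, List.mem_map]
    rintro ⟨t, ht, e⟩
    apply hnot
    rw [MulAut.conj_apply, mul_inv_eq_iff_eq_mul, mul_right_inj] at e
    exact e ▸ ht
  simp only [concat_eq_append, count_append, h4, count_singleton_self, zero_add] at h3
  by_contra hmem
  rw [count_eq_zero.2 hmem] at h3
  simp at h3

/-- The exchange property for a product of two words. -/
theorem exists_mul_simple_eq_or_mem_rightInvSeq {α β : List B} {i : B}
    (h : cs.IsRightDescent (cs.wordProd (α ++ β)) i) :
    (∃ α' : List B, α'.length + 1 = α.length ∧
      cs.wordProd (α ++ β) * cs.simple i = cs.wordProd (α' ++ β)) ∨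
      cs.simple i ∈ cs.rightInvSeq β := by
  obtain ⟨n, hn, e⟩ := List.mem_iff_getElem.1 (cs.simple_mem_rightInvSeq h)
  rcases lt_or_ge n α.length with hlt | hge
  · left
    refine ⟨α.eraseIdx n, List.length_eraseIdx_add_one hlt, ?_⟩
    rw [← e, ← List.getD_eq_getElem _ 1 hn, wordProd_mul_getD_rightInvSeq,
      eraseIdx_append_of_lt_length hlt]
  · right
    -- The right inversion sequence of a suffix is the corresponding suffix of the sequence.
    have hd : β = (α ++ β).drop α.length := by simp
    rw [hd, rightInvSeq_drop, ← e, List.mem_iff_getElem]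
    refine ⟨n - α.length, ?_, ?_⟩
    · rw [length_drop]
      omega
    · rw [getElem_drop]
      congr 1
      omega

theorem mem_rightInvSeq_alternatingWord {i j : B} {k : ℕ} {t : W}
    (h : t ∈ cs.rightInvSeq (alternatingWord i j k)) :
    ∃ l < k, t = cs.simple j * (cs.simple i * cs.simple j) ^ l := by
  induction k with
  | zero => simp [alternatingWord] at h
  | succ k ih =>
    rw [alternatingWord_succ', rightInvSeq, mem_cons] at h
    rcases h with rfl | h
    · refine ⟨k, k.lt_succ_self, ?_⟩
      rw [prod_alternatingWord_eq_mul_pow]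
      rcases Nat.even_or_odd' k with ⟨p, rfl | rfl⟩
      · have e : 2 * p / 2 = p := by omega
        simp only [even_two, Even.mul_right, if_true, one_mul, e]
        rw [inv_pow_mul_simple_mul_pow]
      · have e : (2 * p + 1) / 2 = p := by omega
        have hne : ¬ Even (2 * p + 1) := by simp
        simp only [hne, if_false, e]
        rw [← inv_pow_mul_simple_mul_simple_mul_simple_mul_pow]
        simp [mul_assoc]
    · obtain ⟨l, hl, e⟩ := ih h
      exact ⟨l, hl.trans k.lt_succ_self, e⟩

/-- An equality `s_i = s_j (s_i s_j)^l` would give `(s_i s_j)^(l+1) = 1` with `l + 1 ≤ k`, below the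
exact order. -/
theorem simple_notMem_rightInvSeq_alternatingWord {i j : B} (hij : i ≠ j) {k : ℕ}
    (hk : k < M i j ∨ M i j = 0) :
    cs.simple i ∉ cs.rightInvSeq (alternatingWord i j k) := by
  intro h
  obtain ⟨l, hl, e⟩ := cs.mem_rightInvSeq_alternatingWord h
  refine cs.simple_mul_simple_pow_ne_one hij (Nat.succ_pos l) (by omega) ?_
  rw [pow_succ, ← mul_left_cancel_iff (a := cs.simple j), ← mul_assoc, ← e, mul_one,
    ← mul_assoc, simple_mul_simple_self, one_mul]

end CoxeterSystem

/-! ### Matsumoto's theorem -/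

namespace CoxeterMatrix

/-- The family `f` satisfies the braid relations. -/
def IsBraidFamily {B G : Type*} [Monoid G] (M : CoxeterMatrix B) (f : B → G) : Prop :=
  ∀ i j, i ≠ j → M i j ≠ 0 →
    ((CoxeterSystem.alternatingWord i j (M i j)).map f).prod =
      ((CoxeterSystem.alternatingWord j i (M i j)).map f).prod

end CoxeterMatrix

namespace CoxeterSystem

open List

variable {B W : Type*} [Group W] {M : CoxeterMatrix B} (cs : CoxeterSystem M W)

/-- Grow the alternating tail one letter at a time. The exchange property deletes a letter when a
descent is appended, and that letter cannot lie in the tail, so it comes from `α`. -/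
theorem exists_wordProd_append_alternatingWord_eq {w : W} {i j : B} (hij : i ≠ j)
    (hi : cs.IsRightDescent w i) (hj : cs.IsRightDescent w j) {k : ℕ}
    (hk : k ≤ M i j ∨ M i j = 0) :
    ∃ α : List B, cs.wordProd (α ++ alternatingWord i j k) = w ∧ α.length + k = cs.length w := by
  induction k generalizing i j with
  | zero =>
    obtain ⟨ω, hω, rfl⟩ := cs.exists_isReduced w
    exact ⟨ω, by simp [alternatingWord], hω.symm⟩
  | succ k ih =>
    have hs := M.symmetric i j
    obtain ⟨α, hα, hl⟩ := ih hij.symm hj hi (by omega)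
    rw [← hα] at hj
    rcases cs.exists_mul_simple_eq_or_mem_rightInvSeq hj with ⟨α', hl', e⟩ | h
    · refine ⟨α', ?_, by omega⟩
      rw [alternatingWord_succ, concat_eq_append, ← append_assoc, wordProd_append, ← e, hα]
      simp
    · exact absurd h (cs.simple_notMem_rightInvSeq_alternatingWord hij.symm (by omega))

theorem isRightDescent_of_isReduced_concat {α : List B} {i : B}
    (h : cs.IsReduced (α ++ [i])) : cs.IsRightDescent (cs.wordProd (α ++ [i])) i := by
  have h' := h.eq
  have := cs.length_wordProd_le α
  rw [IsRightDescent, h', wordProd_append, wordProd_singleton, simple_mul_simple_cancel_right,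
    length_append, length_singleton]
  omega

theorem IsReduced.of_append {cs : CoxeterSystem M W} {α β : List B}
    (h : cs.IsReduced (α ++ β)) : cs.IsReduced α := by
  simpa using h.take α.length

/-- **Matsumoto's theorem**: a family that satisfies the braid relations has the same product along
any two reduced words of the same element. -/
theorem matsumoto {G : Type*} [Monoid G] {f : B → G} (hf : M.IsBraidFamily f) {ω ω' : List B}
    (hω : cs.IsReduced ω) (hω' : cs.IsReduced ω') (e : cs.wordProd ω = cs.wordProd ω') :
    (ω.map f).prod = (ω'.map f).prod := by
  induction hn : ω.length generalizing ω ω' with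
  | zero =>
    have hl : ω.length = ω'.length := by rw [← hω.eq, ← hω'.eq, e]
    rw [List.length_eq_zero_iff.1 hn, List.length_eq_zero_iff.1 (hl.symm.trans hn)]
  | succ n ih =>
    have same : ∀ {α β : List B} {i : B}, cs.IsReduced (α ++ [i]) → cs.IsReduced (β ++ [i]) →
        cs.wordProd (α ++ [i]) = cs.wordProd (β ++ [i]) → α.length = n →
        ((α ++ [i]).map f).prod = ((β ++ [i]).map f).prod := by
      intro α β i hα hβ e hn
      rw [wordProd_append, wordProd_append, mul_left_inj] at e
      rw [map_append, map_append, prod_append, prod_append, ih hα.of_append hβ.of_append e hn]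
    have hl : ω.length = ω'.length := by rw [← hω.eq, ← hω'.eq, e]
    obtain rfl | ⟨α, i, rfl⟩ := ω.eq_nil_or_concat
    · simp at hn
    obtain rfl | ⟨β, j, rfl⟩ := ω'.eq_nil_or_concat
    · simp at hl
    rw [concat_eq_append] at *
    rw [concat_eq_append] at *
    have hn' : α.length = n := by simpa using hn
    have hn'' : β.length = n := by simp at hl; omega
    by_cases hij : i = j
    · subst hij
      exact same hω hω' e hn'
    have hdi := cs.isRightDescent_of_isReduced_concat hω
    have hdj := cs.isRightDescent_of_isReduced_concat hω'
    rw [← e] at hdj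
    have hlw : cs.length (cs.wordProd (α ++ [i])) = n + 1 := by rw [hω.eq, hn]
    -- With no relation between `i` and `j` the alternating tail could be longer than the element
    -- itself.
    have hm : M i j ≠ 0 := fun h0 => by
      obtain ⟨γ, -, h⟩ := cs.exists_wordProd_append_alternatingWord_eq hij hdi hdj (k := n + 2)
        (Or.inr h0)
      omega
    obtain ⟨γ, hγ, hγl⟩ := cs.exists_wordProd_append_alternatingWord_eq hij hdi hdj (Or.inl le_rfl)
    have hbraid : cs.wordProd (alternatingWord i j (M i j)) =
        cs.wordProd (alternatingWord j i (M i j)) := by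
      have := cs.wordProd_braidWord_eq i j
      rwa [braidWord, braidWord, M.symmetric j i] at this
    have hγ' : cs.wordProd (γ ++ alternatingWord j i (M i j)) = cs.wordProd (α ++ [i]) := by
      rw [← hγ, wordProd_append, wordProd_append, hbraid]
    have hr : cs.IsReduced (γ ++ alternatingWord i j (M i j)) := by
      rw [IsReduced, hγ, ← hγl, length_append, length_alternatingWord]
    have hr' : cs.IsReduced (γ ++ alternatingWord j i (M i j)) := by
      rw [IsReduced, hγ', ← hγl, length_append, length_alternatingWord]
    have hfb := hf i j hij hm
    have hprod : ((γ ++ alternatingWord i j (M i j)).map f).prod =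
        ((γ ++ alternatingWord j i (M i j)).map f).prod := by
      rw [map_append, map_append, prod_append, prod_append, hfb]
    obtain ⟨m, hm'⟩ := Nat.exists_eq_succ_of_ne_zero hm
    have e1 : γ ++ alternatingWord i j (M i j) = γ ++ alternatingWord j i m ++ [j] := by
      rw [hm', alternatingWord_succ, concat_eq_append, append_assoc]
    have e2 : γ ++ alternatingWord j i (M i j) = γ ++ alternatingWord i j m ++ [i] := by
      rw [hm', alternatingWord_succ, concat_eq_append, append_assoc]
    rw [e1] at hγ hr hprod
    rw [e2] at hγ' hr' hprod
    -- Pass from `α ++ [i]` to the comparison word ending in `i`, apply the braid relation to reach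
    -- the one ending in `j`, and go on to `β ++ [j]`.
    exact (same hω hr' hγ'.symm hn').trans
      (hprod.symm.trans (same hω' hr (e.symm.trans hγ.symm) hn'').symm)

/-- The lift of an element of a Coxeter group to a monoid along a family that satisfies the braid
relations: the product of the family along a reduced word. -/
noncomputable def braidLift {G : Type*} [Monoid G] (f : B → G) (w : W) : G :=
  ((cs.exists_isReduced w).choose.map f).prod

section

variable {G : Type*} [Monoid G] {f : B → G}

theorem braidLift_wordProd (hf : M.IsBraidFamily f) {ω : List B} (hω : cs.IsReduced ω) :
    cs.braidLift f (cs.wordProd ω) = (ω.map f).prod :=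
  have h := (cs.exists_isReduced (cs.wordProd ω)).choose_spec
  cs.matsumoto hf h.1 hω h.2.symm

theorem braidLift_simple (hf : M.IsBraidFamily f) (i : B) :
    cs.braidLift f (cs.simple i) = f i := by
  have h : cs.IsReduced [i] := by simp [IsReduced]
  simpa using cs.braidLift_wordProd hf h

theorem braidLift_mul (hf : M.IsBraidFamily f) {v w : W}
    (h : cs.length (v * w) = cs.length v + cs.length w) :
    cs.braidLift f (v * w) = cs.braidLift f v * cs.braidLift f w := by
  obtain ⟨α, hα, rfl⟩ := cs.exists_isReduced v
  obtain ⟨β, hβ, rfl⟩ := cs.exists_isReduced w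
  have hr : cs.IsReduced (α ++ β) := by
    rw [IsReduced, wordProd_append, h, hα.eq, hβ.eq, length_append]
  rw [← wordProd_append, cs.braidLift_wordProd hf hr, cs.braidLift_wordProd hf hα,
    cs.braidLift_wordProd hf hβ, map_append, prod_append]

theorem braidLift_mem_closure (f : B → G) (w : W) :
    cs.braidLift f w ∈ Submonoid.closure (Set.range f) := by
  refine Submonoid.list_prod_mem _ fun x hx => ?_
  obtain ⟨i, -, rfl⟩ := List.mem_map.1 hx
  exact Submonoid.subset_closure ⟨i, rfl⟩

end

/-! ### Garside elements -/

/-- Every `u` is a right divisor of `w` with additive lengths. Extend a reduced word of `u` by one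
letter at a time: since the extension is reduced, the exchange property must delete a letter in the
complementary factor. -/
theorem length_mul_inv_add_of_forall_isRightDescent {w : W} (hw : ∀ i, cs.IsRightDescent w i)
    (u : W) : cs.length (w * u⁻¹) + cs.length u = cs.length w := by
  obtain ⟨β, hβ, rfl⟩ := cs.exists_isReduced u
  induction β using List.reverseRecOn with
  | nil => simp
  | append_singleton β i ih =>
    have hu := hβ.eq
    have hb := hβ.of_append.eq
    have ih := ih hβ.of_append
    obtain ⟨α, hα, e⟩ := cs.exists_isReduced (w * (cs.wordProd β)⁻¹)
    have ew : w = cs.wordProd (α ++ β) := by rw [wordProd_append, ← e]; simp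
    have hd := hw i
    rw [ew] at hd
    have hα' := hα.eq
    rw [← e] at hα'
    refine le_antisymm ?_ ?_
    · rcases cs.exists_mul_simple_eq_or_mem_rightInvSeq hd with ⟨α', hl, e'⟩ | h
      · have e'' : w * (cs.wordProd (β ++ [i]))⁻¹ = cs.wordProd α' := by
          rw [wordProd_append, mul_inv_rev, wordProd_singleton, inv_simple, ← mul_assoc, ew, e',
            wordProd_append, mul_inv_cancel_right]
        have := cs.length_wordProd_le α'
        rw [e'', hu, length_append, length_singleton]
        omega
      · have := (cs.isRightInversion_of_mem_rightInvSeq hβ.of_append h).2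
        rw [wordProd_append, wordProd_singleton, length_append, length_singleton] at hu
        omega
    · simpa using cs.length_mul_le (w * (cs.wordProd (β ++ [i]))⁻¹) (cs.wordProd (β ++ [i]))

theorem exists_forall_isRightDescent [Finite W] : ∃ w : W, ∀ i, cs.IsRightDescent w i := by
  obtain ⟨w, hw⟩ := Finite.exists_max cs.length
  exact ⟨w, fun i => lt_of_le_of_ne (hw _) (cs.length_mul_simple_ne w i)⟩

/-- A Garside element: it is positive, right divisible by all generators, and conjugation by it
maps generators to generators. -/
theorem exists_garside_element (cs : CoxeterSystem M W) [Finite W] {G : Type*} [Monoid G]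
    {f : B → G}
    (hf : M.IsBraidFamily f) :
    ∃ Δ ∈ Submonoid.closure (Set.range f),
      (∀ i, ∃ p ∈ Submonoid.closure (Set.range f), Δ = p * f i) ∧
      ∀ i, ∃ j, Δ * f i = f j * Δ := by
  obtain ⟨w, hw⟩ := cs.exists_forall_isRightDescent
  have key : ∀ i, cs.braidLift f w = cs.braidLift f (w * cs.simple i) * f i := fun i => by
    have h := cs.braidLift_mul hf (v := w * cs.simple i) (w := cs.simple i) (by
      have := cs.isRightDescent_iff.1 (hw i)
      simpa using this.symm)
    rwa [simple_mul_simple_cancel_right, cs.braidLift_simple hf] at h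
  refine ⟨cs.braidLift f w, cs.braidLift_mem_closure f w,
    fun i => ⟨_, cs.braidLift_mem_closure f _, key i⟩, fun i => ?_⟩
  -- The left complement of `w s_i` in `w` has length 1, say `w = s_j (w s_i)`. Lifting this and `w
  -- = (w s_i) s_i` gives `Δ f_i = f_j Δ`.
  have h1 := cs.length_mul_inv_add_of_forall_isRightDescent hw (w * cs.simple i)
  have h2 := cs.isRightDescent_iff.1 (hw i)
  obtain ⟨j, hj⟩ := cs.length_eq_one_iff.1
    (show cs.length (w * (w * cs.simple i)⁻¹) = 1 by omega)
  refine ⟨j, ?_⟩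
  have h := cs.braidLift_mul hf (v := w * (w * cs.simple i)⁻¹) (w := w * cs.simple i) (by
    rw [inv_mul_cancel_right]
    omega)
  rw [inv_mul_cancel_right, hj, cs.braidLift_simple hf] at h
  nth_rw 1 [h]
  rw [mul_assoc, ← key]

/-- In the group generated by a family that satisfies the braid relations of a finite Coxeter group,
all elements are left fractions of positive elements. -/
theorem exists_inv_mul_eq_of_mem_closure (cs : CoxeterSystem M W) [Finite W] {G : Type*} [Group G]
    {f : B → G}
    (hf : M.IsBraidFamily f) {g : G} (hg : g ∈ Subgroup.closure (Set.range f)) :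
    ∃ b ∈ Submonoid.closure (Set.range f), ∃ c ∈ Submonoid.closure (Set.range f),
      g = b⁻¹ * c := by
  obtain ⟨Δ, hΔ, hdiv, hconj⟩ := cs.exists_garside_element hf
  have hconj' : ∀ c ∈ Submonoid.closure (Set.range f),
      ∃ c' ∈ Submonoid.closure (Set.range f), Δ * c = c' * Δ := by
    intro c hc
    induction hc using Submonoid.closure_induction with
    | mem x hx =>
      obtain ⟨i, rfl⟩ := hx
      obtain ⟨j, hj⟩ := hconj i
      exact ⟨f j, Submonoid.subset_closure ⟨j, rfl⟩, hj⟩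
    | one => exact ⟨1, one_mem _, by simp⟩
    | mul x y _ _ hx hy =>
      obtain ⟨x', hx', ex⟩ := hx
      obtain ⟨y', hy', ey⟩ := hy
      exact ⟨x' * y', mul_mem hx' hy', by rw [← mul_assoc, ex, mul_assoc, ey, mul_assoc]⟩
  induction hg using Subgroup.closure_induction_right with
  | one => exact ⟨1, one_mem _, 1, one_mem _, by simp⟩
  | mul_right x hx y hy ih =>
    obtain ⟨b, hb, c, hc, rfl⟩ := ih
    exact ⟨b, hb, c * y, mul_mem hc (Submonoid.subset_closure hy), by rw [mul_assoc]⟩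
  | mul_inv_cancel x hx y hy ih =>
    obtain ⟨b, hb, c, hc, rfl⟩ := ih
    obtain ⟨i, rfl⟩ := hy
    obtain ⟨p, hp, ep⟩ := hdiv i
    obtain ⟨c', hc', ec⟩ := hconj' c hc
    -- With `Δ = p f_i` and `Δ c = c' Δ`: `b⁻¹ c f_i⁻¹ = b⁻¹ c Δ⁻¹ p = b⁻¹ Δ⁻¹ c' p`.
    refine ⟨Δ * b, mul_mem hΔ hb, c' * p, mul_mem hc' hp, ?_⟩
    have e1 : (f i)⁻¹ = Δ⁻¹ * p := by
      rw [ep]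
      group
    have e2 : c * Δ⁻¹ = Δ⁻¹ * c' := by
      rw [mul_inv_eq_iff_eq_mul, mul_assoc, ← ec, inv_mul_cancel_left]
    rw [e1, mul_inv_rev, mul_assoc, ← mul_assoc c, e2]
    simp only [mul_assoc]

end CoxeterSystem

/-! ### Piecewise affine functions on realizations -/

namespace AbstractSimplicialComplex.Realization

variable {V : Type*} {K : AbstractSimplicialComplex V}

/-- The function on the realization that is affine on simplices with given values on vertices. -/
noncomputable def affineExtension (F : V → ℝ) (x : K.Realization) : ℝ :=
  x.1.sum fun v r => r * F v

theorem affineExtension_vertex (F : V → ℝ) (v : V) :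
    affineExtension F (vertex K v) = F v := by
  simp [affineExtension, vertex]

theorem sum_eq_one_of_support_subset (x : K.Realization) {s : Finset V} (h : x.1.support ⊆ s) :
    ∑ v ∈ s, x.1 v = 1 := by
  have := x.2.2.1
  rwa [Finsupp.sum_of_support_subset _ h _ (by simp)] at this

theorem simplexDist_eq_of_support_subset {x y : K.Realization} {s : Finset V}
    (hx : x.1.support ⊆ s) (hy : y.1.support ⊆ s) :
    simplexDist x y = Real.sqrt ((1 / 2) * ∑ v ∈ s, (x.1 v - y.1 v) ^ 2) := by
  classical
  rw [simplexDist, Finsupp.sum_of_support_subset (s := s) _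
    (Finsupp.support_sub.trans (Finset.union_subset hx hy)) _ (by simp)]
  simp

theorem simplexDist_le_one {x y : K.Realization} (h : InCommonSimplex x y) :
    simplexDist x y ≤ 1 := by
  obtain ⟨s, -, hx, hy⟩ := h
  have bound : ∀ z : K.Realization, z.1.support ⊆ s → ∑ v ∈ s, z.1 v ^ 2 ≤ 1 := by
    intro z hz
    refine le_of_le_of_eq (Finset.sum_le_sum fun v hv => ?_) (sum_eq_one_of_support_subset z hz)
    have h1 : z.1 v ≤ 1 :=
      (Finset.single_le_sum (fun w _ => z.2.1 w) hv).trans_eq (sum_eq_one_of_support_subset z hz)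
    nlinarith [z.2.1 v]
  rw [simplexDist_eq_of_support_subset hx hy, Real.sqrt_le_one]
  -- The cross terms may be dropped because barycentric coordinates are nonnegative.
  have : ∑ v ∈ s, (x.1 v - y.1 v) ^ 2 ≤ ∑ v ∈ s, (x.1 v ^ 2 + y.1 v ^ 2) :=
    Finset.sum_le_sum fun v _ => by nlinarith [mul_nonneg (x.2.1 v) (y.2.1 v)]
  rw [Finset.sum_add_distrib] at this
  linarith [bound x hx, bound y hy]

theorem edist_le_one_of_inCommonSimplex {x y : K.Realization} (h : InCommonSimplex x y) :
    edist x y ≤ 1 := by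
  have hs : IsString x y 1 fun i => if i = 0 then x else y := by
    refine ⟨rfl, rfl, fun i hi => ?_⟩
    obtain rfl : i = 0 := by omega
    exact h
  refine (pathDist_le hs).trans ?_
  simpa [stringLength] using simplexDist_le_one h

/-- A function on vertices whose variation on simplices is bounded extends to a Lipschitz function,
if the dimension is bounded. -/
theorem lipschitzWith_affineExtension {N : ℕ} (hN₀ : 0 < N) (hN : ∀ s ∈ K.faces, s.card ≤ N)
    {F : V → ℝ}
    {D : ℝ≥0} (hD : 0 < D) (hF : ∀ s ∈ K.faces, ∀ v ∈ s, ∀ w ∈ s, |F v - F w| ≤ D) :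
    LipschitzWith (D * NNReal.sqrt (2 * N)) (affineExtension (K := K) F) := by
  have step : ∀ x y : K.Realization, InCommonSimplex x y →
      |affineExtension F x - affineExtension F y| ≤
        (D * NNReal.sqrt (2 * N) : ℝ≥0) * simplexDist x y := by
    rintro x y ⟨s, hs, hx, hy⟩
    obtain ⟨v₀, hv₀⟩ := (K.isRelLowerSet_faces hs).1
    -- The coordinates of both points sum to 1, so a constant may be subtracted from `F`.
    have e : affineExtension F x - affineExtension F y =
        ∑ v ∈ s, (x.1 v - y.1 v) * (F v - F v₀) := by
      rw [affineExtension, affineExtension, Finsupp.sum_of_support_subset _ hx _ (by simp),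
        Finsupp.sum_of_support_subset _ hy _ (by simp), ← Finset.sum_sub_distrib]
      simp only [mul_sub, sub_mul, Finset.sum_sub_distrib, ← Finset.sum_mul,
        sum_eq_one_of_support_subset x hx, sum_eq_one_of_support_subset y hy]
      ring
    have h1 : |affineExtension F x - affineExtension F y| ≤ D * ∑ v ∈ s, |x.1 v - y.1 v| := by
      rw [e, Finset.mul_sum]
      refine (Finset.abs_sum_le_sum_abs _ _).trans (Finset.sum_le_sum fun v hv => ?_)
      rw [abs_mul, mul_comm]
      exact mul_le_mul_of_nonneg_right (hF s hs v hv v₀ hv₀) (abs_nonneg _)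
    -- Cauchy–Schwarz; the factor 2 undoes the `1 / 2` in `simplexDist`.
    have h2 : ∑ v ∈ s, |x.1 v - y.1 v| ≤ Real.sqrt (2 * N) * simplexDist x y := by
      rw [simplexDist_eq_of_support_subset hx hy, ← Real.sqrt_mul (by positivity)]
      refine Real.le_sqrt_of_sq_le ?_
      refine sq_sum_le_card_mul_sum_sq.trans ?_
      simp only [sq_abs]
      have hc : (s.card : ℝ) ≤ N := by exact_mod_cast hN s hs
      have hp : 0 ≤ ∑ v ∈ s, (x.1 v - y.1 v) ^ 2 := Finset.sum_nonneg fun v _ => sq_nonneg _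
      nlinarith [mul_le_mul_of_nonneg_right hc hp]
    refine h1.trans ((mul_le_mul_of_nonneg_left h2 D.2).trans (le_of_eq ?_))
    rw [NNReal.coe_mul, Real.coe_sqrt, mul_assoc]
    simp
  intro x y
  change _ ≤ _ * pathDist x y
  -- A nonzero finite constant commutes with the infimum over strings.
  have h0 : ((D * NNReal.sqrt (2 * N) : ℝ≥0) : ℝ≥0∞) ≠ 0 := by
    rw [ENNReal.coe_ne_zero]
    positivity
  simp only [pathDist, ENNReal.mul_iInf_of_ne h0 ENNReal.coe_ne_top]
  refine le_iInf fun n => le_iInf fun c => le_iInf fun h => ?_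
  rw [stringLength, Finset.mul_sum, ← h.1, ← h.2.1]
  refine (edist_le_range_sum_edist (fun i => affineExtension F (c i)) n).trans
    (Finset.sum_le_sum fun i hi => ?_)
  rw [edist_dist, Real.dist_eq, ← ENNReal.ofReal_coe_nnreal,
    ← ENNReal.ofReal_mul (NNReal.coe_nonneg _)]
  exact ENNReal.ofReal_le_ofReal (step _ _ (h.2.2 i (Finset.mem_range.1 hi)))

end AbstractSimplicialComplex.Realization

/-! ### Cayley graphs of submonoids -/

section Cayley

namespace SimpleGraph

variable {G : Type*} [Group G] {S : Submonoid G}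

theorem mulCayley_reachable_mul (g : G) {m : G} (hm : m ∈ S) :
    (mulCayley (S : Set G)).Reachable g (g * m) := by
  by_cases h : g = g * m
  · rw [← h]
  · refine Adj.reachable ?_
    rw [mulCayley_adj']
    exact ⟨h, m, hm, Or.inl rfl⟩

theorem mulCayley_connected {s : Set G} (hs : s ⊆ S) (h : Subgroup.closure s = ⊤) :
    (mulCayley (S : Set G)).Connected := by
  have key : ∀ x ∈ Subgroup.closure s, ∀ g : G, (mulCayley (S : Set G)).Reachable g (g * x) := by
    intro x hx
    induction hx using Subgroup.closure_induction with
    | mem x hx => exact fun g => mulCayley_reachable_mul g (hs hx)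
    | one => simp
    | mul x y _ _ hx hy => exact fun g => by simpa [mul_assoc] using (hx g).trans (hy (g * x))
    | inv x _ hx => exact fun g => by simpa using (hx (g * x⁻¹)).symm
  exact ⟨fun g h' => by simpa using key (g⁻¹ * h') (by simp [h]) g⟩

theorem mulCayley_dist_mul_le_one (g : G) {m : G} (hm : m ∈ S) :
    (mulCayley (S : Set G)).dist g (g * m) ≤ 1 := by
  by_cases h : g = g * m
  · simp [← h]
  · refine (dist_eq_one_iff_adj.2 ?_).le
    rw [mulCayley_adj']
    exact ⟨h, m, hm, Or.inl rfl⟩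

end SimpleGraph

end Cayley

/-! ### Cosets of special subgroups of spherical type -/

namespace CoxeterSystem

theorem map_alternatingWord {B C : Type*} (f : B → C) (i j : B) (m : ℕ) :
    (alternatingWord i j m).map f = alternatingWord (f i) (f j) m := by
  induction m generalizing i j with
  | zero => rfl
  | succ m ih => simp [alternatingWord_succ, ih]

end CoxeterSystem

namespace CoxeterMatrix

variable {B : Type*} (M : CoxeterMatrix B)

theorem isBraidFamily_artinGen : M.IsBraidFamily M.artinGen := by
  intro i j hij hm
  have e : ∀ i j : B, ∀ m, ((CoxeterSystem.alternatingWord i j m).map M.artinGen).prod =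
      PresentedGroup.mk M.artinRelators (artinWord i j m) := by
    intro i j m
    rw [artinWord, map_list_prod, List.map_map]
    rfl
  rw [e, e]
  exact PresentedGroup.mk_eq_mk_of_mul_inv_mem ⟨i, j, hij, hm, rfl⟩

theorem IsBraidFamily.restrict {G : Type*} [Monoid G] {M : CoxeterMatrix B} {f : B → G}
    (hf : M.IsBraidFamily f) (T : Set B) :
    (M.restrict T).IsBraidFamily fun i : T => f i := by
  intro i j hij hm
  have := hf i j (fun h => hij (Subtype.ext h)) hm
  have e : (fun i : T => f i) = f ∘ Subtype.val := rfl
  simp only [e, ← List.map_map, CoxeterSystem.map_alternatingWord Subtype.val]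
  exact this

theorem closure_range_artinGen : Subgroup.closure (Set.range M.artinGen) = ⊤ :=
  PresentedGroup.closure_range_of _

theorem artinMonoid_cayley_connected :
    (SimpleGraph.mulCayley (M.artinMonoid : Set M.ArtinGroup)).Connected :=
  SimpleGraph.mulCayley_connected Submonoid.subset_closure M.closure_range_artinGen

/-- Elements of special subgroups of spherical type are left fractions of positive elements. -/
theorem exists_inv_mul_eq_of_mem_specialSubgroup {T : Set B} (hT : (M.restrict T).IsSpherical)
    {g : M.ArtinGroup} (hg : g ∈ M.specialSubgroup T) :
    ∃ b ∈ M.artinMonoid, ∃ c ∈ M.artinMonoid, g = b⁻¹ * c := by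
  have e : M.artinGen '' T = Set.range fun i : T => M.artinGen i := Set.image_eq_range _ _
  rw [specialSubgroup, e] at hg
  have : Finite (M.restrict T).Group := hT
  obtain ⟨b, hb, c, hc, h⟩ := (M.restrict T).toCoxeterSystem.exists_inv_mul_eq_of_mem_closure
    (M.isBraidFamily_artinGen.restrict T) hg
  have hle : Submonoid.closure (Set.range fun i : T => M.artinGen i) ≤ M.artinMonoid :=
    Submonoid.closure_mono (by rintro _ ⟨i, rfl⟩; exact ⟨i, rfl⟩)
  exact ⟨b, hle hb, c, hle hc, h⟩

/-- If `x⁻¹ y = b⁻¹ c`, then `x b⁻¹` is within distance 1 of both `x` and `y`. Left fractions are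
the right ones here, since edges are right multiplications. -/
theorem dist_le_two_of_mem_deligneVertex (c : M.DeligneVertex) {x y : M.ArtinGroup}
    (hx : x ∈ c.1) (hy : y ∈ c.1) :
    (SimpleGraph.mulCayley (M.artinMonoid : Set M.ArtinGroup)).dist x y ≤ 2 := by
  obtain ⟨g, T, hT, e⟩ := c.2
  rw [e, Set.mem_smul_set_iff_inv_smul_mem, smul_eq_mul, SetLike.mem_coe] at hx hy
  have hxy : x⁻¹ * y ∈ M.specialSubgroup T := by
    have := mul_mem (inv_mem hx) hy
    rwa [show (g⁻¹ * x)⁻¹ * (g⁻¹ * y) = x⁻¹ * y by group] at this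
  obtain ⟨b, hb, c, hc, h⟩ := M.exists_inv_mul_eq_of_mem_specialSubgroup hT hxy
  have h1 := SimpleGraph.mulCayley_dist_mul_le_one (x * b⁻¹) hb
  have h2 := SimpleGraph.mulCayley_dist_mul_le_one (x * b⁻¹) hc
  rw [inv_mul_cancel_right, SimpleGraph.dist_comm] at h1
  rw [mul_assoc, ← h, mul_inv_cancel_left] at h2
  have := M.artinMonoid_cayley_connected.dist_triangle (u := x) (v := x * b⁻¹) (w := y)
  omega

end CoxeterMatrix

/-! ### Simplices of the coned-off Deligne complex -/

namespace CoxeterMatrix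

open AbstractSimplicialComplex AbstractSimplicialComplex.Realization

variable {B : Type*} (M : CoxeterMatrix B)

variable {M} in
theorem DeligneVertex.nonempty (c : M.DeligneVertex) : c.1.Nonempty := by
  obtain ⟨g, T, -, e⟩ := c.2
  rw [e]
  exact ⟨g, 1, one_mem _, mul_one g⟩

variable {M} in
theorem DeligneVertex.exists_eq_smul_of_mem {c : M.DeligneVertex} {x : M.ArtinGroup}
    (hx : x ∈ c.1) : ∃ T : Set B, c.1 = x • (M.specialSubgroup T : Set M.ArtinGroup) := by
  obtain ⟨g, T, -, e⟩ := c.2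
  rw [e, Set.mem_smul_set_iff_inv_smul_mem, smul_eq_mul, SetLike.mem_coe] at hx
  exact ⟨T, e.trans ((leftCoset_eq_iff _).2 hx)⟩

/-- All cosets in a chain contain a common point `x` of the smallest one, so each has the form `x
A_T`, and there are at most as many as subsets `T`. -/
theorem card_le_of_mem_deligneComplex [Finite B] {s : Finset M.DeligneVertex}
    (hs : s ∈ M.deligneComplex.faces) : s.card ≤ Nat.card (Set B) := by
  classical
  have := Fintype.ofFinite (Set B)
  obtain ⟨c₀, hc₀, hmin⟩ := s.exists_minimal hs.1
  obtain ⟨x, hx⟩ := c₀.nonempty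
  have hle : ∀ c ∈ s, c₀ ≤ c := fun c hc => (hs.2.total hc₀ hc).elim id fun h => hmin hc h
  rw [← Finset.card_image_of_injective s Subtype.val_injective, Nat.card_eq_fintype_card]
  refine (Finset.card_le_card (t := Finset.univ.image fun T : Set B =>
    x • (M.specialSubgroup T : Set M.ArtinGroup)) fun y hy => ?_).trans Finset.card_image_le
  obtain ⟨c, hc, rfl⟩ := Finset.mem_image.1 hy
  obtain ⟨T, hT⟩ := DeligneVertex.exists_eq_smul_of_mem (hle c hc hx)
  exact Finset.mem_image.2 ⟨T, Finset.mem_univ T, hT.symm⟩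

theorem card_le_of_mem_conedOffDeligneComplex [Finite B]
    {s : Finset (M.DeligneVertex ⊕ M.ArtinGroup)} (hs : s ∈ M.conedOffDeligneComplex.faces) :
    s.card ≤ Nat.card (Set B) + 1 := by
  rw [← Finset.card_toLeft_add_card_toRight]
  rcases hs with ⟨h0, h⟩ | ⟨g, hg, h | h⟩
  · rw [h0]
    exact (M.card_le_of_mem_deligneComplex h).trans (Nat.le_succ _)
  · simp [h, hg]
  · rw [hg]
    exact Nat.add_le_add_right (M.card_le_of_mem_deligneComplex (M.translate_le g h)) 1

/-- An element of the group attached to each vertex of the coned-off Deligne complex. -/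
noncomputable def vertexRep : M.DeligneVertex ⊕ M.ArtinGroup → M.ArtinGroup :=
  Sum.elim (fun c => c.nonempty.some) id

theorem vertexRep_mem (c : M.DeligneVertex) : M.vertexRep (Sum.inl c) ∈ c.1 :=
  c.nonempty.some_mem

theorem exists_mul_mem_of_mem_translate {g : M.ArtinGroup} {s : Finset M.DeligneVertex}
    (hs : s ∈ (M.translate g).faces) {c : M.DeligneVertex} (hc : c ∈ s) :
    ∃ m ∈ M.artinMonoid, g * m ∈ c.1 := by
  classical
  obtain ⟨t, ht, rfl⟩ := hs
  obtain ⟨d, hd, rfl⟩ := Finset.mem_image.1 hc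
  obtain ⟨m, hm, T, -, e⟩ := ht.2 d hd
  refine ⟨m, hm, ?_⟩
  change g * m ∈ g • d.1
  rw [e]
  exact Set.smul_mem_smul_set ⟨1, one_mem _, mul_one m⟩

/-- Nested cosets contribute 2, the diameter of the larger one. For a cone vertex `g` and a coset
containing `gm` the bound is `1 + 2`. A simplex has at most one cone vertex. -/
theorem dist_vertexRep_le {s : Finset (M.DeligneVertex ⊕ M.ArtinGroup)}
    (hs : s ∈ M.conedOffDeligneComplex.faces) {v w : M.DeligneVertex ⊕ M.ArtinGroup}
    (hv : v ∈ s) (hw : w ∈ s) :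
    (SimpleGraph.mulCayley (M.artinMonoid : Set M.ArtinGroup)).dist (M.vertexRep v)
      (M.vertexRep w) ≤ 3 := by
  have hll : ∀ c d, c ∈ s.toLeft → d ∈ s.toLeft →
      (SimpleGraph.mulCayley (M.artinMonoid : Set M.ArtinGroup)).dist (M.vertexRep (Sum.inl c))
        (M.vertexRep (Sum.inl d)) ≤ 3 := by
    intro c d hc hd
    have hchain : IsChain (· ≤ ·) (s.toLeft : Set M.DeligneVertex) := by
      rcases hs with ⟨-, h⟩ | ⟨g, -, h | h⟩
      · exact h.2
      · simp [h]
      · exact (M.translate_le g h).2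
    rcases hchain.total hc hd with h | h
    · exact (M.dist_le_two_of_mem_deligneVertex d (h (M.vertexRep_mem c))
        (M.vertexRep_mem d)).trans (by norm_num)
    · exact (M.dist_le_two_of_mem_deligneVertex c (M.vertexRep_mem c)
        (h (M.vertexRep_mem d))).trans (by norm_num)
  have hlr : ∀ c k, c ∈ s.toLeft → k ∈ s.toRight →
      (SimpleGraph.mulCayley (M.artinMonoid : Set M.ArtinGroup)).dist (M.vertexRep (Sum.inl c))
        k ≤ 3 := by
    intro c k hc hk
    rcases hs with ⟨h0, -⟩ | ⟨g, hg, h | h⟩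
    · simp [h0] at hk
    · simp [h] at hc
    · rw [hg, Finset.mem_singleton] at hk
      subst hk
      obtain ⟨m, hm, hmem⟩ := M.exists_mul_mem_of_mem_translate h hc
      have h1 := SimpleGraph.mulCayley_dist_mul_le_one k hm
      have h2 := M.dist_le_two_of_mem_deligneVertex c (M.vertexRep_mem c) hmem
      have h3 := M.artinMonoid_cayley_connected.dist_triangle (u := M.vertexRep (Sum.inl c))
        (v := k * m) (w := k)
      rw [SimpleGraph.dist_comm] at h1
      omega
  rcases v with c | k <;> rcases w with d | l
  · exact hll c d (Finset.mem_toLeft.2 hv) (Finset.mem_toLeft.2 hw)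
  · exact hlr c l (Finset.mem_toLeft.2 hv) (Finset.mem_toRight.2 hw)
  · rw [SimpleGraph.dist_comm]
    exact hlr d k (Finset.mem_toLeft.2 hw) (Finset.mem_toRight.2 hv)
  · have hk := Finset.mem_toRight.2 hv
    have hl := Finset.mem_toRight.2 hw
    rcases hs with ⟨h0, -⟩ | ⟨g, hg, -⟩
    · simp [h0] at hk
    · rw [hg, Finset.mem_singleton] at hk hl
      simp [hk, hl]

/-! ### Distances in the coned-off Deligne complex -/

/-- The vertex `g m A_T` of the Deligne complex spans an edge with the cone vertex `v_g`. -/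
theorem edist_coneVertex_vertex_le_one {g : M.ArtinGroup} {c : M.DeligneVertex}
    (hc : ∃ m ∈ M.artinMonoid, g * m ∈ c.1) :
    edist (vertex M.conedOffDeligneComplex (Sum.inr g))
      (vertex M.conedOffDeligneComplex (Sum.inl c)) ≤ 1 := by
  classical
  obtain ⟨m, hm, hmem⟩ := hc
  obtain ⟨x, T, hT, e⟩ := c.2
  have hc' : c.1 = (g * m) • (M.specialSubgroup T : Set M.ArtinGroup) := by
    rw [e, Set.mem_smul_set_iff_inv_smul_mem, smul_eq_mul, SetLike.mem_coe] at hmem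
    exact e.trans ((leftCoset_eq_iff _).2 hmem)
  let d : M.DeligneVertex := ⟨m • (M.specialSubgroup T : Set M.ArtinGroup), m, T, hT, rfl⟩
  have hd : g • d = c := Subtype.ext (by
    change g • (m • (M.specialSubgroup T : Set M.ArtinGroup)) = c.1
    rw [hc', smul_smul])
  have hface : ({c} : Finset M.DeligneVertex) ∈ (M.translate g).faces := by
    refine ⟨{d}, ⟨M.deligneComplex.singleton_mem d, fun c' hc' => ?_⟩, by simp [hd]⟩
    rw [Finset.mem_singleton.1 hc']
    exact ⟨m, hm, T, hT, rfl⟩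
  refine edist_le_one_of_inCommonSimplex ⟨{Sum.inl c, Sum.inr g}, ?_, ?_, ?_⟩
  · have e1 : ({Sum.inl c, Sum.inr g} : Finset (M.DeligneVertex ⊕ M.ArtinGroup)).toRight = {g} := by
      ext; simp
    have e2 : ({Sum.inl c, Sum.inr g} : Finset (M.DeligneVertex ⊕ M.ArtinGroup)).toLeft = {c} := by
      ext; simp
    exact Or.inr ⟨g, e1, Or.inr (e2 ▸ hface)⟩
  · exact Finsupp.support_single_subset.trans (by simp)
  · exact Finsupp.support_single_subset.trans (by simp)

theorem isSpherical_restrict_empty : (M.restrict ∅).IsSpherical := by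
  have : Subsingleton (M.restrict ∅).Group := by
    refine ⟨fun a b => ?_⟩
    have h : ∀ a : (M.restrict ∅).Group, a = 1 := fun a =>
      (M.restrict ∅).toCoxeterSystem.simple_induction_left (p := (· = 1)) a rfl
        fun _ i _ => i.2.elim
    rw [h a, h b]
  exact Finite.of_subsingleton

theorem edist_coneVertex_mul_le_two (g : M.ArtinGroup) {m : M.ArtinGroup}
    (hm : m ∈ M.artinMonoid) :
    edist (vertex M.conedOffDeligneComplex (Sum.inr g))
      (vertex M.conedOffDeligneComplex (Sum.inr (g * m))) ≤ 2 := by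
  let c : M.DeligneVertex := ⟨(g * m) • (M.specialSubgroup ∅ : Set M.ArtinGroup), g * m, ∅,
    M.isSpherical_restrict_empty, rfl⟩
  have hmem : g * m ∈ c.1 := ⟨1, one_mem _, mul_one _⟩
  have h1 := M.edist_coneVertex_vertex_le_one ⟨m, hm, hmem⟩
  have h2 := M.edist_coneVertex_vertex_le_one (g := g * m) (c := c)
    ⟨1, one_mem _, by rwa [mul_one]⟩
  rw [edist_comm] at h2
  refine (edist_triangle _ _ _).trans ((add_le_add h1 h2).trans ?_)
  norm_num

theorem edist_coneVertexMap_le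
    (g h : GraphVertex (SimpleGraph.mulCayley (M.artinMonoid : Set M.ArtinGroup))) :
    edist (M.coneVertexMap g) (M.coneVertexMap h) ≤ 2 * edist g h := by
  obtain ⟨p, hp⟩ := (M.artinMonoid_cayley_connected.preconnected g.val
    h.val).exists_walk_length_eq_edist
  have key : ∀ {x y : M.ArtinGroup}
      (p : (SimpleGraph.mulCayley (M.artinMonoid : Set M.ArtinGroup)).Walk x y),
      edist (vertex M.conedOffDeligneComplex (Sum.inr x))
        (vertex M.conedOffDeligneComplex (Sum.inr y)) ≤ 2 * (p.length : ℝ≥0∞) := by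
    intro x y p
    induction p with
    | nil => simp
    | @cons u v w hadj p ih =>
      rw [SimpleGraph.Walk.length_cons, Nat.cast_succ, mul_add, mul_one, add_comm]
      refine (edist_triangle _ _ _).trans (add_le_add ?_ ih)
      rw [SimpleGraph.mulCayley_adj'] at hadj
      obtain ⟨-, m, hm, rfl | rfl⟩ := hadj
      · exact M.edist_coneVertex_mul_le_two u hm
      · rw [edist_comm]
        exact M.edist_coneVertex_mul_le_two v hm
  refine (key p).trans (le_of_eq ?_)
  change 2 * (p.length : ℝ≥0∞) = 2 * ((SimpleGraph.edist _ _ _ : ℕ∞) : ℝ≥0∞)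
  rw [← hp, ENat.toENNReal_coe]

theorem edist_eq_dist
    (g h : GraphVertex (SimpleGraph.mulCayley (M.artinMonoid : Set M.ArtinGroup))) :
    edist g h = ((SimpleGraph.mulCayley (M.artinMonoid : Set M.ArtinGroup)).dist g.val h.val :
      ℝ≥0∞) := by
  change ((SimpleGraph.edist _ _ _ : ℕ∞) : ℝ≥0∞) = _
  rw [← (M.artinMonoid_cayley_connected.preconnected g.val h.val).coe_dist_eq_edist,
    ENat.toENNReal_coe]

/-- In the constant, 3 bounds the variation of `d(g, ·)` on a simplex and `Nat.card (Set B) + 1` the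
number of its vertices. -/
theorem edist_le_edist_coneVertexMap [Finite B]
    (g h : GraphVertex (SimpleGraph.mulCayley (M.artinMonoid : Set M.ArtinGroup))) :
    edist g h ≤ ((3 * NNReal.sqrt (2 * (Nat.card (Set B) + 1 : ℕ)) : ℝ≥0) : ℝ≥0∞) *
      edist (M.coneVertexMap g) (M.coneVertexMap h) := by
  let d : M.ArtinGroup → ℕ :=
    (SimpleGraph.mulCayley (M.artinMonoid : Set M.ArtinGroup)).dist g.val
  have hd : ∀ x y, d y ≤ d x +
      (SimpleGraph.mulCayley (M.artinMonoid : Set M.ArtinGroup)).dist x y := fun x y =>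
    M.artinMonoid_cayley_connected.dist_triangle
  have hF : ∀ s ∈ M.conedOffDeligneComplex.faces, ∀ v ∈ s, ∀ w ∈ s,
      |(d (M.vertexRep v) : ℝ) - d (M.vertexRep w)| ≤ (3 : ℝ≥0) := by
    intro s hs v hv w hw
    have h1 : (d (M.vertexRep w) : ℝ) ≤ d (M.vertexRep v) + 3 := by
      exact_mod_cast (hd _ _).trans (Nat.add_le_add_left (M.dist_vertexRep_le hs hv hw) _)
    have h2 : (d (M.vertexRep v) : ℝ) ≤ d (M.vertexRep w) + 3 := by
      exact_mod_cast (hd _ _).trans (Nat.add_le_add_left (M.dist_vertexRep_le hs hw hv) _)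
    rw [abs_le, NNReal.coe_ofNat]
    constructor <;> linarith
  have hlip := lipschitzWith_affineExtension (Nat.succ_pos (Nat.card (Set B)))
    (fun s hs => M.card_le_of_mem_conedOffDeligneComplex hs) (by norm_num) hF
    (M.coneVertexMap g) (M.coneVertexMap h)
  refine le_of_eq_of_le ?_ hlip
  rw [coneVertexMap, coneVertexMap, affineExtension_vertex, affineExtension_vertex]
  have e1 : d (M.vertexRep (Sum.inr g.val)) = 0 := SimpleGraph.dist_self
  rw [M.edist_eq_dist, e1, edist_comm, edist_dist, Nat.cast_zero, Real.dist_0_eq_abs, Nat.abs_cast,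
    ENNReal.ofReal_natCast]
  rfl

theorem exists_edist_coneVertexMap_le_two (p : M.conedOffDeligneComplex.Realization) :
    ∃ g, edist p (M.coneVertexMap g) ≤ 2 := by
  have hp := p.2.2.2
  obtain ⟨v, hv⟩ := (M.conedOffDeligneComplex.isRelLowerSet_faces hp).1
  have h1 : edist p (vertex M.conedOffDeligneComplex v) ≤ 1 :=
    edist_le_one_of_inCommonSimplex ⟨_, hp, subset_rfl,
      Finsupp.support_single_subset.trans (Finset.singleton_subset_iff.2 hv)⟩
  rcases v with c | g
  · obtain ⟨g, hg⟩ := c.nonempty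
    have h2 := M.edist_coneVertex_vertex_le_one (g := g) (c := c) ⟨1, one_mem _, by rwa [mul_one]⟩
    rw [edist_comm] at h2
    refine ⟨⟨g⟩, (edist_triangle _ _ _).trans ((add_le_add h1 h2).trans ?_)⟩
    norm_num
  · exact ⟨⟨g⟩, h1.trans (by norm_num)⟩

end CoxeterMatrix

/-! ### The quasi-isometry -/

theorem theorem3p2 {B : Type*} [Finite B] (M : CoxeterMatrix B) (hM : M.IsInfiniteType) :
    (∀ g h : GraphVertex (SimpleGraph.mulCayley (M.artinMonoid : Set M.ArtinGroup)),
      edist g h ≠ ⊤) ∧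
    (∀ p q : M.conedOffDeligneComplex.Realization, edist p q ≠ ⊤) ∧
    IsQuasiIsometry M.coneVertexMap := by
  have hfin : ∀ g h : GraphVertex (SimpleGraph.mulCayley (M.artinMonoid : Set M.ArtinGroup)),
      edist g h ≠ ⊤ := fun g h => by
    rw [M.edist_eq_dist]
    exact ENNReal.natCast_ne_top _
  refine ⟨hfin, fun p q => ?_, ?_⟩
  · obtain ⟨g, hg⟩ := M.exists_edist_coneVertexMap_le_two p
    obtain ⟨h, hh⟩ := M.exists_edist_coneVertexMap_le_two q
    have h1 : edist (M.coneVertexMap g) (M.coneVertexMap h) ≠ ⊤ :=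
      ((M.edist_coneVertexMap_le g h).trans_lt
        (ENNReal.mul_lt_top (by norm_num) (hfin g h).lt_top)).ne
    have h2 := edist_triangle4 p (M.coneVertexMap g) (M.coneVertexMap h) q
    rw [edist_comm (M.coneVertexMap h) q] at h2
    refine (h2.trans_lt (ENNReal.add_lt_top.2 ⟨ENNReal.add_lt_top.2 ⟨?_, h1.lt_top⟩, ?_⟩)).ne
    · exact hg.trans_lt (by norm_num)
    · exact hh.trans_lt (by norm_num)
  · set L : ℝ≥0 := 3 * NNReal.sqrt (2 * (Nat.card (Set B) + 1 : ℕ))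
    have hA : (1 : ℝ≥0) ≤ max 2 L := le_max_of_le_left (by norm_num)
    -- Both distance bounds hold without additive error; the constant 2 serves only coarse
    -- surjectivity.
    refine ⟨max 2 L, 2, hA, fun g h => ⟨?_, ?_⟩, fun p => ?_⟩
    · refine ((M.edist_coneVertexMap_le g h).trans ?_).trans le_self_add
      gcongr
      exact_mod_cast le_max_left 2 L
    · refine le_trans ?_ le_self_add
      refine (mul_le_mul_right (M.edist_le_edist_coneVertexMap g h) _).trans ?_
      rw [← mul_assoc, ← ENNReal.coe_mul]
      refine mul_le_of_le_one_left zero_le ?_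
      rw [ENNReal.coe_le_one_iff, inv_mul_le_iff₀ (by positivity), mul_one]
      exact le_max_right 2 L
    · simpa using M.exists_edist_coneVertexMap_le_two p
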